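/- Let $T>0$ and let $u_0:\mathbf R^n\to\mathbf R$ be Lipschitz continuous with Lipschitz constant $L_0$. Let $H_1:\mathbf R^n\times[0,T]\times\mathbf R^n\to\mathbf R$ be continuous and such that * $H_1(x,t,\lambda p)=\lambda H_1(x,t,p)$ for all $\lambda>0$ and all $(x,t,p)$; * there is $D\in C([0,T])$ with $|H_1(x,t,p)-H_1(y,t,p)|\le D(t)|x-y|$ for all $x,y\in\mathbf R^n$, $t\in[0,T]$ and $|p|=1$; * there is $L_2>0$ with $|H_1(x,t,p)-H_1(x,t,q)|\le L_2|p-q|$ for all $x,p,q\in\mathbf R^n$, $t\in[0,T]$; * $\sup\{|H_1(x,t,p)| : x\in\mathbf R^n,\ t\in[0,T],\ |p|=1\}<\infty$. Let $\beta:\mathbf R\to\mathbf R$ be Lipschitz continuous, non-decreasing and bounded, with $\beta(0)=0$, $\beta(r)>0$ for $r>0$ and $\beta(r)<0$ for $r<0$. Let $h:\mathbf R^n\to\mathbf R$ satisfy $|h(p)-h(q)|\le\omega_h(|p-q|)$ for all $p,q$, where $\omega_h:[0,\infty)\to[0,\infty)$ is non-decreasing with $\omega_h(0)=0=\lim_{r\to0}\omega_h(r)$,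 and suppose that $h(p)>0$ for $|p|<1$ and that either $h(p)<0$ for all $|p|>1$, or $h(p)=0$ for all $|p|\ge1$. Let $\theta>0$ and let $u\in C(\mathbf R^n\times[0,T))$ be a viscosity solution of $$u_t=H_1(x,t,\nabla u)+\theta\,\beta(u)\,h(\nabla u)\quad\text{in }\mathbf R^n\times(0,T),\qquad u(x,0)=u_0(x)\quad\text{in }\mathbf R^n,$$ with at most linear growth, i.e. $|u(x,t)|\le K(1+|x|)$ on $\mathbf R^n\times(0,T)$ for some $K>0$. Then $$|u(x,t)-u(y,t)|\le \max\{L_0,1\}\,e^{\int_0^tD(s)\,ds}\,|x-y|\qquad\text{for all }x,y\in\mathbf R^n,\ t\in[0,T).$$ In particular the bound does not depend on $\theta$. -/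

import Mathlib

open Set Filter Topology
open scoped NNReal

/-- A modulus: a non-decreasing function `ω : [0,∞) → [0,∞)` with `ω 0 = 0` and
`ω r → 0` as `r → 0`. -/
structure IsModulus (ω : ℝ≥0 → ℝ≥0) : Prop where
  mono : Monotone ω
  zero : ω 0 = 0
  tendsto : Tendsto ω (𝓝 0) (𝓝 0)

/-- The structural conditions on a geometric Hamiltonian `H(x,t,p)` on `ℝⁿ × [0,T] × ℝⁿ`, apart
from its regularity in `x`: continuity, positive homogeneity in `p`, Lipschitz continuity in `p`
uniformly in `(x,t)`, and boundedness for `|p| = 1`. The values of `H` at times outside `[0,T]`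
are irrelevant. -/
structure IsGeometricHamiltonian (n : ℕ) (T : ℝ)
    (H : EuclideanSpace ℝ (Fin n) → ℝ → EuclideanSpace ℝ (Fin n) → ℝ) : Prop where
  cont : ContinuousOn
    (fun z : EuclideanSpace ℝ (Fin n) × ℝ × EuclideanSpace ℝ (Fin n) => H z.1 z.2.1 z.2.2)
    (univ ×ˢ (Icc 0 T ×ˢ univ))
  homog : ∀ c > 0, ∀ x, ∀ t ∈ Icc 0 T, ∀ p, H x t (c • p) = c * H x t p
  lip_p : ∃ L₂ > 0, ∀ x, ∀ t ∈ Icc 0 T, ∀ p q, |H x t p - H x t q| ≤ L₂ * ‖p - q‖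
  bdd : ∃ C, ∀ x, ∀ t ∈ Icc 0 T, ∀ p, ‖p‖ = 1 → |H x t p| ≤ C

/-- `H(·,t,p)` is Lipschitz with constant `D t` for every `t ∈ [0,T]` and every unit vector `p`,
where `D` is continuous on `[0,T]`. -/
structure IsLipschitzInSpace (n : ℕ) (T : ℝ)
    (H : EuclideanSpace ℝ (Fin n) → ℝ → EuclideanSpace ℝ (Fin n) → ℝ) (D : ℝ → ℝ) : Prop where
  cont : ContinuousOn D (Icc 0 T)
  lip : ∀ x y, ∀ t ∈ Icc 0 T, ∀ p, ‖p‖ = 1 → |H x t p - H y t p| ≤ D t * ‖x - y‖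

/-- The conditions on `β`: Lipschitz, non-decreasing, bounded, and of the same sign as its
argument. -/
structure IsSignLike (β : ℝ → ℝ) : Prop where
  lip : ∃ Lβ : ℝ≥0, LipschitzWith Lβ β
  mono : Monotone β
  bdd : ∃ M, ∀ r, |β r| ≤ M
  zero : β 0 = 0
  pos : ∀ r, 0 < r → 0 < β r
  neg : ∀ r, r < 0 → β r < 0

/-- The function `h` has a global modulus of continuity. -/
def HasModulus (n : ℕ) (h : EuclideanSpace ℝ (Fin n) → ℝ) : Prop :=
  ∃ ω : ℝ≥0 → ℝ≥0, IsModulus ω ∧ ∀ p q, |h p - h q| ≤ ω ‖p - q‖₊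

/-- `h > 0` in the open unit ball and `h < 0` outside the closed unit ball. -/
def ChangesSignAtUnitSphere (n : ℕ) (h : EuclideanSpace ℝ (Fin n) → ℝ) : Prop :=
  (∀ p, ‖p‖ < 1 → 0 < h p) ∧ (∀ p, 1 < ‖p‖ → h p < 0)

/-- `h > 0` in the open unit ball and `h = 0` outside it. -/
def VanishesOutsideUnitBall (n : ℕ) (h : EuclideanSpace ℝ (Fin n) → ℝ) : Prop :=
  (∀ p, ‖p‖ < 1 → 0 < h p) ∧ (∀ p, 1 ≤ ‖p‖ → h p = 0)

/-- Viscosity subsolution of `u_t = F(x,t,u,∇u)` in `ℝⁿ × (0,T)`, for `u` and `F` continuous there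
(so that they coincide with their semicontinuous envelopes): whenever a `C¹` function `φ` touches
`u` from above at `(x₀,t₀)`, one has `φ_t ≤ F(x₀,t₀,φ,∇φ)` at `(x₀,t₀)`. -/
def IsViscositySubsolution (n : ℕ) (T : ℝ)
    (F : EuclideanSpace ℝ (Fin n) → ℝ → ℝ → EuclideanSpace ℝ (Fin n) → ℝ)
    (u : EuclideanSpace ℝ (Fin n) → ℝ → ℝ) : Prop :=
  ∀ φ : EuclideanSpace ℝ (Fin n) → ℝ → ℝ,
    ContDiffOn ℝ 1 (fun P : EuclideanSpace ℝ (Fin n) × ℝ => φ P.1 P.2) (univ ×ˢ Ioo 0 T) →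
    ∀ x₀, ∀ t₀ ∈ Ioo 0 T,
      (∀ᶠ P : EuclideanSpace ℝ (Fin n) × ℝ in 𝓝 (x₀, t₀), u P.1 P.2 ≤ φ P.1 P.2) →
      u x₀ t₀ = φ x₀ t₀ →
      deriv (fun t => φ x₀ t) t₀ ≤ F x₀ t₀ (φ x₀ t₀) (gradient (fun x => φ x t₀) x₀)

/-- Viscosity supersolution of `u_t = F(x,t,u,∇u)` in `ℝⁿ × (0,T)`, for `u` and `F` continuous
there: whenever a `C¹` function `φ` touches `u` from below at `(x₀,t₀)`, one has
`φ_t ≥ F(x₀,t₀,φ,∇φ)` at `(x₀,t₀)`. -/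
def IsViscositySupersolution (n : ℕ) (T : ℝ)
    (F : EuclideanSpace ℝ (Fin n) → ℝ → ℝ → EuclideanSpace ℝ (Fin n) → ℝ)
    (u : EuclideanSpace ℝ (Fin n) → ℝ → ℝ) : Prop :=
  ∀ φ : EuclideanSpace ℝ (Fin n) → ℝ → ℝ,
    ContDiffOn ℝ 1 (fun P : EuclideanSpace ℝ (Fin n) × ℝ => φ P.1 P.2) (univ ×ˢ Ioo 0 T) →
    ∀ x₀, ∀ t₀ ∈ Ioo 0 T,
      (∀ᶠ P : EuclideanSpace ℝ (Fin n) × ℝ in 𝓝 (x₀, t₀), φ P.1 P.2 ≤ u P.1 P.2) →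
      u x₀ t₀ = φ x₀ t₀ →
      F x₀ t₀ (φ x₀ t₀) (gradient (fun x => φ x t₀) x₀) ≤ deriv (fun t => φ x₀ t) t₀

/-- `u ∈ C(ℝⁿ × [0,T))` is a viscosity solution of `u_t = F(x,t,u,∇u)` in `ℝⁿ × (0,T)` with
`u(·,0) = u₀`, of at most linear growth in `x` (the class in which solutions are unique). -/
structure IsCauchySolution (n : ℕ) (T : ℝ)
    (F : EuclideanSpace ℝ (Fin n) → ℝ → ℝ → EuclideanSpace ℝ (Fin n) → ℝ)
    (u₀ : EuclideanSpace ℝ (Fin n) → ℝ) (u : EuclideanSpace ℝ (Fin n) → ℝ → ℝ) : Prop where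
  cont : ContinuousOn (fun P : EuclideanSpace ℝ (Fin n) × ℝ => u P.1 P.2) (univ ×ˢ Ico 0 T)
  sub : IsViscositySubsolution n T F u
  super : IsViscositySupersolution n T F u
  init : ∀ x, u x 0 = u₀ x
  growth : ∃ K > 0, ∀ x, ∀ t ∈ Ioo 0 T, |u x t| ≤ K * (1 + ‖x‖)

section Calculus

variable {V : Type*} [NormedAddCommGroup V]

/-- A smooth function with linear growth: `√(1 + ‖x‖²)`. -/
noncomputable def japaneseBracket (x : V) : ℝ := √(1 + ‖x‖ ^ 2)

theorem japaneseBracket_pos (x : V) : 0 < japaneseBracket x :=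
  Real.sqrt_pos.2 (by positivity)

theorem norm_le_japaneseBracket (x : V) : ‖x‖ ≤ japaneseBracket x :=
  Real.le_sqrt_of_sq_le (by linarith)

variable [InnerProductSpace ℝ V]

theorem HasDerivAt.hasGradientAt_norm_sub_sq [CompleteSpace V] {g : ℝ → ℝ} {g' : ℝ} {x y : V}
    (hg : HasDerivAt g g' (‖x - y‖ ^ 2)) :
    HasGradientAt (fun z => g (‖z - y‖ ^ 2)) ((2 * g') • (x - y)) x := by
  rw [hasGradientAt_iff_hasFDerivAt]
  have h1 : HasFDerivAt (fun z : V => z - y) (ContinuousLinearMap.id ℝ V) x :=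
    (hasFDerivAt_id x).sub_const y
  have h2 := hg.comp_hasFDerivAt x h1.norm_sq
  refine h2.congr_fderiv ?_
  ext z
  simp
  ring

theorem contDiff_japaneseBracket : ContDiff ℝ 1 (japaneseBracket : V → ℝ) :=
  (contDiff_const.add (contDiff_id.norm_sq ℝ)).sqrt fun x => by positivity

theorem continuous_japaneseBracket : Continuous (japaneseBracket : V → ℝ) :=
  contDiff_japaneseBracket.continuous

theorem hasGradientAt_japaneseBracket_sub [CompleteSpace V] (x y : V) :
    HasGradientAt (fun z => japaneseBracket (z - y))
      ((japaneseBracket (x - y))⁻¹ • (x - y)) x := by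
  have hpos : 1 + ‖x - y‖ ^ 2 ≠ 0 := by positivity
  have h1 : HasDerivAt (fun s : ℝ => √(1 + s)) (1 / (2 * √(1 + ‖x - y‖ ^ 2))) (‖x - y‖ ^ 2) :=
    ((hasDerivAt_id (‖x - y‖ ^ 2)).const_add 1).sqrt hpos
  have h2 : (japaneseBracket (x - y))⁻¹ = 2 * (1 / (2 * √(1 + ‖x - y‖ ^ 2))) := by
    change (√(1 + ‖x - y‖ ^ 2))⁻¹ = _
    field_simp
  rw [h2]
  exact h1.hasGradientAt_norm_sub_sq

theorem norm_inv_japaneseBracket_smul_le (x : V) : ‖(japaneseBracket x)⁻¹ • x‖ ≤ 1 := by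
  rw [norm_smul, norm_inv, Real.norm_of_nonneg (japaneseBracket_pos x).le,
    inv_mul_le_one₀ (japaneseBracket_pos x)]
  exact norm_le_japaneseBracket x

end Calculus

section Test

variable {n : ℕ} {T : ℝ} {F : EuclideanSpace ℝ (Fin n) → ℝ → ℝ → EuclideanSpace ℝ (Fin n) → ℝ}
  {u : EuclideanSpace ℝ (Fin n) → ℝ → ℝ}

theorem IsViscositySubsolution.le_of_local_max (hu : IsViscositySubsolution n T F u)
    {φ : EuclideanSpace ℝ (Fin n) → ℝ → ℝ}
    (hφ : ContDiff ℝ 1 (fun P : EuclideanSpace ℝ (Fin n) × ℝ => φ P.1 P.2))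
    {x₀ g : EuclideanSpace ℝ (Fin n)} {t₀ a : ℝ} (ht₀ : t₀ ∈ Ioo 0 T)
    (hmax : ∀ᶠ P : EuclideanSpace ℝ (Fin n) × ℝ in 𝓝 (x₀, t₀),
      u P.1 P.2 - φ P.1 P.2 ≤ u x₀ t₀ - φ x₀ t₀)
    (ha : HasDerivAt (fun t => φ x₀ t) a t₀) (hg : HasGradientAt (fun x => φ x t₀) g x₀) :
    a ≤ F x₀ t₀ (u x₀ t₀) g := by
  have := hu (fun x t => φ x t + (u x₀ t₀ - φ x₀ t₀)) (hφ.add contDiff_const).contDiffOn x₀ t₀ ht₀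
    (hmax.mono fun P hP => by linarith) (by ring)
  have hg' : HasGradientAt (fun x => φ x t₀ + (u x₀ t₀ - φ x₀ t₀)) g x₀ := by
    rw [hasGradientAt_iff_hasFDerivAt] at hg ⊢
    exact hg.add_const _
  rw [(ha.add_const _).deriv, hg'.gradient] at this
  simpa using this

theorem IsViscositySupersolution.neg (hu : IsViscositySupersolution n T F u) :
    IsViscositySubsolution n T (fun x t r p => -F x t (-r) (-p)) (fun x t => -u x t) := by
  intro φ hφ x₀ t₀ ht₀ hle heq
  have := hu (fun x t => -φ x t) hφ.neg x₀ t₀ ht₀ (hle.mono fun P hP => by linarith) (by linarith)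
  have hg : gradient (fun x => -φ x t₀) x₀ = -gradient (fun x => φ x t₀) x₀ := by
    simp only [gradient]
    rw [fderiv_fun_neg, map_neg]
  rw [hg, deriv.fun_neg] at this
  linarith

end Test

section Growth

theorem HasModulus.continuous {n : ℕ} {h : EuclideanSpace ℝ (Fin n) → ℝ} (hh : HasModulus n h) :
    Continuous h := by
  obtain ⟨ω, hω, hhω⟩ := hh
  refine continuous_iff_continuousAt.2 fun q => ?_
  rw [ContinuousAt, tendsto_iff_dist_tendsto_zero]
  have h1 : Tendsto (fun p => ((ω ‖p - q‖₊ : ℝ≥0) : ℝ)) (𝓝 q) (𝓝 0) := by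
    rw [← NNReal.coe_zero, NNReal.tendsto_coe]
    refine hω.tendsto.comp ?_
    have : Continuous fun p : EuclideanSpace ℝ (Fin n) => ‖p - q‖₊ := by fun_prop
    simpa using this.tendsto q
  exact squeeze_zero (fun _ => dist_nonneg) (fun p => by rw [Real.dist_eq]; exact hhω p q) h1

theorem HasModulus.linear_growth {n : ℕ} {h : EuclideanSpace ℝ (Fin n) → ℝ}
    (hh : HasModulus n h) : ∃ A ≥ 0, ∀ p, |h p| ≤ A * (1 + ‖p‖) := by
  obtain ⟨ω, hω, hhω⟩ := hh
  have key : ∀ N : ℕ, ∀ p, ‖p‖ ≤ N → |h p - h 0| ≤ N * ω 1 := by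
    intro N
    induction N with
    | zero => intro p hp; have : p = 0 := by simpa using hp
              simp [this]
    | succ N ih =>
      intro p hp
      push_cast at hp ⊢
      have hN : (0 : ℝ) < N + 1 := by positivity
      have h1 := ih (((N : ℝ) / (N + 1)) • p) (by
        rw [norm_smul, Real.norm_of_nonneg (by positivity), div_mul_eq_mul_div, div_le_iff₀ hN]
        gcongr)
      have h2 : ‖p - ((N : ℝ) / (N + 1)) • p‖₊ ≤ 1 := by
        have : p - ((N : ℝ) / (N + 1)) • p = ((1 : ℝ) / (N + 1)) • p := by
          rw [← one_smul ℝ p, smul_smul, ← sub_smul, smul_smul]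
          congr 1
          field_simp
          ring
        rw [this, ← NNReal.coe_le_coe, coe_nnnorm, norm_smul,
          Real.norm_of_nonneg (by positivity), div_mul_eq_mul_div, NNReal.coe_one, div_le_one hN]
        linarith
      have h3 : |h p - h (((N : ℝ) / (N + 1)) • p)| ≤ ω 1 :=
        (hhω _ _).trans (NNReal.coe_le_coe.2 (hω.mono h2))
      have := abs_sub_le (h p) (h (((N : ℝ) / (N + 1)) • p)) (h 0)
      linarith
  refine ⟨|h 0| + ω 1, by positivity, fun p => ?_⟩
  have h1 := key ⌈‖p‖⌉₊ p (Nat.le_ceil _)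
  have h2 := (Nat.ceil_lt_add_one (norm_nonneg p)).le
  have h3 : |h p| ≤ |h p - h 0| + |h 0| := by
    simpa using abs_add_le (h p - h 0) (h 0)
  have h4 : (⌈‖p‖⌉₊ : ℝ) * ω 1 ≤ (‖p‖ + 1) * ω 1 := by gcongr
  nlinarith [mul_nonneg (abs_nonneg (h 0)) (norm_nonneg p)]

theorem IsGeometricHamiltonian.linear_growth {n : ℕ} {T : ℝ}
    {H : EuclideanSpace ℝ (Fin n) → ℝ → EuclideanSpace ℝ (Fin n) → ℝ}
    (hH : IsGeometricHamiltonian n T H) :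
    ∃ L ≥ 0, ∀ x, ∀ t ∈ Icc 0 T, ∀ p, |H x t p| ≤ L * ‖p‖ := by
  obtain ⟨L, hL, hLip⟩ := hH.lip_p
  refine ⟨L, hL.le, fun x t ht p => ?_⟩
  have h0 : H x t 0 = 0 := by
    have := hH.homog 2 two_pos x t ht 0
    rw [smul_zero] at this
    linarith
  simpa [h0] using hLip x t ht p 0

end Growth

theorem ContinuousOn.exists_isMaxOn_of_superlevel_subset {X : Type*} [TopologicalSpace X]
    {f : X → ℝ} {s K : Set X} (hf : ContinuousOn f s) (hK : IsCompact K) (hKs : K ⊆ s) {x₁ : X}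
    (hx₁ : x₁ ∈ s) (hsub : ∀ x ∈ s, f x₁ ≤ f x → x ∈ K) : ∃ z ∈ K, ∀ w ∈ s, f w ≤ f z := by
  obtain ⟨z, hzK, hz⟩ := hK.exists_isMaxOn ⟨x₁, hsub x₁ hx₁ le_rfl⟩ (hf.mono hKs)
  refine ⟨z, hzK, fun w hw => ?_⟩
  by_cases h : f x₁ ≤ f w
  · exact hz (hsub w hw h)
  · exact (not_le.1 h).le.trans (hz (hsub x₁ hx₁ le_rfl))

theorem exists_lt_mul_exp (B : ℝ) {η d : ℝ} (hη : 0 < η) (hd : 0 < d) :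
    ∃ k > 0, B < η * Real.exp (k * d) := by
  refine ⟨|B| / (η * d) + 1, by positivity, ?_⟩
  have h1 := Real.add_one_le_exp ((|B| / (η * d) + 1) * d)
  have h2 : η * ((|B| / (η * d) + 1) * d + 1) = |B| + η * d + η := by field_simp
  have h3 := mul_le_mul_of_nonneg_left h1 hη.le
  have := le_abs_self B
  nlinarith [mul_pos hη hd]

section Barrier

variable {n : ℕ} {T : ℝ}

theorem IsViscositySubsolution.le_barrier
    {F : EuclideanSpace ℝ (Fin n) → ℝ → ℝ → EuclideanSpace ℝ (Fin n) → ℝ}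
    {u : EuclideanSpace ℝ (Fin n) → ℝ → ℝ} (hu : IsViscositySubsolution n T F u)
    (hcont : ContinuousOn (fun P : EuclideanSpace ℝ (Fin n) × ℝ => u P.1 P.2) (univ ×ˢ Ico 0 T))
    {C K L c : ℝ} (hC : 0 ≤ C) (hK : 0 ≤ K) (hL : 0 ≤ L)
    (hF : ∀ x, ∀ t ∈ Ioo 0 T, ∀ r p, F x t r p ≤ C * (1 + ‖p‖))
    (hgrowth : ∀ x, ∀ t ∈ Ioo 0 T, u x t ≤ K * (1 + ‖x‖))
    {y : EuclideanSpace ℝ (Fin n)} (hinit : ∀ x, u x 0 ≤ c + L * ‖x - y‖)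
    (x₁ : EuclideanSpace ℝ (Fin n)) {t₁ : ℝ} (ht₁ : t₁ ∈ Ico 0 T) :
    u x₁ t₁ ≤ c + L * japaneseBracket (x₁ - y) + C * (1 + L) * t₁ := by
  have hinit' : ∀ x, u x 0 ≤ c + L * japaneseBracket (x - y) := fun x =>
    (hinit x).trans (by gcongr; exact norm_le_japaneseBracket _)
  rcases ht₁.1.eq_or_lt with rfl | ht₁0
  · simpa using hinit' x₁
  by_contra! hlt
  set δ := u x₁ t₁ - (c + L * japaneseBracket (x₁ - y) + C * (1 + L) * t₁) with hδ
  have hδ0 : 0 < δ := by linarith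
  obtain ⟨T', ht₁T', hT'T⟩ := exists_between ht₁.2
  set α := δ / 3 / ((1 + ‖x₁‖ ^ 2) * Real.exp (C * t₁)) with hα
  have hα0 : 0 < α := by positivity
  have hα1 : α * ((1 + ‖x₁‖ ^ 2) * Real.exp (C * t₁)) = δ / 3 := by
    rw [hα]; exact div_mul_cancel₀ _ (by positivity)
  set B := K + K ^ 2 / (2 * α) + |c| with hB
  have hB0 : 0 ≤ B := by positivity
  obtain ⟨k, hk, hkB⟩ := exists_lt_mul_exp B (show 0 < δ / 3 by linarith) (sub_pos.2 ht₁T')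
  set φ : EuclideanSpace ℝ (Fin n) → ℝ → ℝ := fun x t => c + L * japaneseBracket (x - y) +
    C * (1 + L) * t + α * ((1 + ‖x‖ ^ 2) * Real.exp (C * t)) +
    δ / 3 * Real.exp (k * (t - t₁)) with hφ
  have hφC : ContDiff ℝ 1 (fun P : EuclideanSpace ℝ (Fin n) × ℝ => φ P.1 P.2) := by
    have h1 : ContDiff ℝ 1 (fun P : EuclideanSpace ℝ (Fin n) × ℝ => japaneseBracket (P.1 - y)) :=
      contDiff_japaneseBracket.comp (contDiff_fst.sub contDiff_const)
    have h2 : ContDiff ℝ 1 (fun P : EuclideanSpace ℝ (Fin n) × ℝ => ‖P.1‖ ^ 2) :=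
      contDiff_fst.norm_sq ℝ
    simp only [hφ]
    fun_prop
  have hbound : ∀ x, ∀ t ∈ Ioo 0 T, u x t - φ x t ≤
      B - α * ‖x‖ ^ 2 / 2 - δ / 3 * Real.exp (k * (t - t₁)) := by
    intro x t ht
    have h1 := hgrowth x t ht
    have h2 : K * ‖x‖ ≤ K ^ 2 / (2 * α) + α * ‖x‖ ^ 2 / 2 := by
      have : K ^ 2 / (2 * α) + α * ‖x‖ ^ 2 / 2 - K * ‖x‖ = (K - α * ‖x‖) ^ 2 / (2 * α) := by
        field_simp
        ring
      have : 0 ≤ (K - α * ‖x‖) ^ 2 / (2 * α) := by positivity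
      linarith
    have h3 : α * ‖x‖ ^ 2 ≤ α * ((1 + ‖x‖ ^ 2) * Real.exp (C * t)) := by
      have : 1 ≤ Real.exp (C * t) := Real.one_le_exp (mul_nonneg hC ht.1.le)
      gcongr
      nlinarith [sq_nonneg ‖x‖]
    have h4 : 0 ≤ L * japaneseBracket (x - y) := mul_nonneg hL (japaneseBracket_pos _).le
    have h5 : 0 ≤ C * (1 + L) * t := mul_nonneg (by positivity) ht.1.le
    have := neg_abs_le c
    simp only [hφ, hB]
    linarith
  have hzero : ∀ x, u x 0 - φ x 0 < 0 := by
    intro x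
    have h1 := hinit' x
    have h2 : 0 < α * ((1 + ‖x‖ ^ 2) * Real.exp (C * 0)) := by positivity
    have h3 : 0 < δ / 3 * Real.exp (k * (0 - t₁)) := by positivity
    simp only [hφ]
    linarith
  have hval : u x₁ t₁ - φ x₁ t₁ = δ / 3 := by
    simp only [hφ, hα1, sub_self, mul_zero, Real.exp_zero]
    linarith
  obtain ⟨⟨x₀, t₀⟩, hP₀, hmax⟩ := ContinuousOn.exists_isMaxOn_of_superlevel_subset
    (f := fun P : EuclideanSpace ℝ (Fin n) × ℝ => u P.1 P.2 - φ P.1 P.2)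
    (s := univ ×ˢ Icc 0 T') (K := Metric.closedBall 0 (1 + 2 * B / α) ×ˢ Icc 0 T')
    (x₁ := (x₁, t₁))
    ((hcont.mono (prod_mono subset_rfl (Icc_subset_Ico_right hT'T))).sub hφC.continuous.continuousOn)
    ((isCompact_closedBall _ _).prod isCompact_Icc) (prod_mono (subset_univ _) subset_rfl)
    ⟨mem_univ _, ht₁0.le, ht₁T'.le⟩ (by
      rintro ⟨x, t⟩ ⟨-, ht⟩ hle
      refine ⟨?_, ht⟩
      simp only at hle ht
      rw [hval] at hle
      rcases ht.1.eq_or_lt with rfl | ht0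
      · linarith [hzero x]
      have h1 := hbound x t ⟨ht0, ht.2.trans_lt hT'T⟩
      have h2 : 0 < δ / 3 * Real.exp (k * (t - t₁)) := by positivity
      have h3 : ‖x‖ ^ 2 ≤ 2 * B / α := by
        rw [le_div_iff₀ hα0]
        linarith
      rw [mem_closedBall_zero_iff]
      nlinarith [norm_nonneg x])
  have hval₀ : δ / 3 ≤ u x₀ t₀ - φ x₀ t₀ := hval ▸ hmax (x₁, t₁) ⟨mem_univ _, ht₁0.le, ht₁T'.le⟩
  obtain ⟨-, ht₀⟩ := hP₀
  simp only at ht₀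
  have ht₀0 : 0 < t₀ := by
    rcases ht₀.1.eq_or_lt with rfl | h
    · linarith [hzero x₀]
    · exact h
  have ht₀T' : t₀ < T' := by
    rcases ht₀.2.eq_or_lt with rfl | h
    · have h1 := hbound x₀ t₀ ⟨ht₀0, hT'T⟩
      have : 0 ≤ α * ‖x₀‖ ^ 2 / 2 := by positivity
      linarith
    · exact h
  have key := hu.le_of_local_max hφC (x₀ := x₀) (t₀ := t₀)
    (a := C * (1 + L) + α * ((1 + ‖x₀‖ ^ 2) * (Real.exp (C * t₀) * C)) +
      δ / 3 * (Real.exp (k * (t₀ - t₁)) * k))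
    (g := L • ((japaneseBracket (x₀ - y))⁻¹ • (x₀ - y)) + (2 * (α * Real.exp (C * t₀))) • x₀)
    ⟨ht₀0, ht₀T'.trans hT'T⟩ (by
      have : ∀ᶠ P : EuclideanSpace ℝ (Fin n) × ℝ in 𝓝 (x₀, t₀), P.2 ∈ Icc 0 T' :=
        continuous_snd.continuousAt.eventually (Icc_mem_nhds ht₀0 ht₀T')
      exact this.mono fun P hP => hmax P ⟨mem_univ _, hP⟩) (by
      have h1 : HasDerivAt (fun t => Real.exp (C * t)) (Real.exp (C * t₀) * C) t₀ := by
        simpa using ((hasDerivAt_id t₀).const_mul C).exp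
      have h2 : HasDerivAt (fun t => Real.exp (k * (t - t₁))) (Real.exp (k * (t₀ - t₁)) * k) t₀ := by
        simpa using (((hasDerivAt_id t₀).sub_const t₁).const_mul k).exp
      have h3 : HasDerivAt (fun t => C * (1 + L) * t) (C * (1 + L)) t₀ := by
        simpa using (hasDerivAt_id t₀).const_mul (C * (1 + L))
      exact ((h3.const_add _).add ((h1.const_mul _).const_mul α)).add (h2.const_mul (δ / 3))) (by
      have h1 := hasGradientAt_japaneseBracket_sub x₀ y
      have h2 : HasGradientAt (fun x : EuclideanSpace ℝ (Fin n) =>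
          α * ((1 + ‖x - 0‖ ^ 2) * Real.exp (C * t₀)))
          ((2 * (α * Real.exp (C * t₀))) • (x₀ - 0)) x₀ := by
        have h3 : HasDerivAt (fun s : ℝ => α * ((1 + s) * Real.exp (C * t₀)))
            (α * Real.exp (C * t₀)) (‖x₀ - 0‖ ^ 2) := by
          simpa using ((((hasDerivAt_id (‖x₀ - 0‖ ^ 2)).const_add 1).mul_const
            (Real.exp (C * t₀))).const_mul α)
        exact h3.hasGradientAt_norm_sub_sq
      simp only [sub_zero] at h2
      rw [hasGradientAt_iff_hasFDerivAt] at h1 h2 ⊢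
      have := ((((h1.const_mul L).const_add c).add_const (C * (1 + L) * t₀)).add h2).add_const
        (δ / 3 * Real.exp (k * (t₀ - t₁)))
      refine this.congr_fderiv ?_
      simp only [map_add, map_smul])
  have hFle := hF x₀ t₀ ⟨ht₀0, ht₀T'.trans hT'T⟩ (u x₀ t₀)
    (L • ((japaneseBracket (x₀ - y))⁻¹ • (x₀ - y)) + (2 * (α * Real.exp (C * t₀))) • x₀)
  have hnorm : ‖L • ((japaneseBracket (x₀ - y))⁻¹ • (x₀ - y)) + (2 * (α * Real.exp (C * t₀))) • x₀‖
      ≤ L + α * (1 + ‖x₀‖ ^ 2) * Real.exp (C * t₀) := by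
    refine (norm_add_le _ _).trans (add_le_add ?_ ?_)
    · rw [norm_smul, Real.norm_of_nonneg hL]
      exact mul_le_of_le_one_right hL (norm_inv_japaneseBracket_smul_le _)
    · rw [norm_smul, Real.norm_of_nonneg (by positivity)]
      have : 0 < α * Real.exp (C * t₀) := by positivity
      nlinarith [sq_nonneg (‖x₀‖ - 1)]
  have h1 := mul_le_mul_of_nonneg_left hnorm hC
  have h2 : 0 < δ / 3 * (Real.exp (k * (t₀ - t₁)) * k) := by positivity
  linarith

theorem IsCauchySolution.abs_sub_initial_le
    {F : EuclideanSpace ℝ (Fin n) → ℝ → ℝ → EuclideanSpace ℝ (Fin n) → ℝ}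
    {u₀ : EuclideanSpace ℝ (Fin n) → ℝ} {u : EuclideanSpace ℝ (Fin n) → ℝ → ℝ}
    (hu : IsCauchySolution n T F u₀ u) {L₀ : ℝ≥0} (hu₀ : LipschitzWith L₀ u₀) {C : ℝ} (hC : 0 ≤ C)
    (hF : ∀ x, ∀ t ∈ Ioo 0 T, ∀ r p, |F x t r p| ≤ C * (1 + ‖p‖))
    (x : EuclideanSpace ℝ (Fin n)) {t : ℝ} (ht : t ∈ Ico 0 T) :
    |u x t - u₀ x| ≤ L₀ + C * (1 + L₀) * T := by
  obtain ⟨K, hK, hgrowth⟩ := hu.growth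
  have hlip : ∀ z, |u z 0 - u₀ x| ≤ L₀ * ‖z - x‖ := fun z => by
    rw [hu.init, ← Real.norm_eq_abs, ← dist_eq_norm, ← dist_eq_norm]
    exact hu₀.dist_le_mul z x
  have hbr : japaneseBracket (x - x) = 1 := by simp [japaneseBracket]
  have h1 := hu.sub.le_barrier hu.cont (L := (L₀ : ℝ)) hC hK.le L₀.coe_nonneg
    (fun z s hs r p => (le_abs_self _).trans (hF z s hs r p))
    (fun z s hs => (le_abs_self _).trans (hgrowth z s hs)) (c := u₀ x) (y := x)
    (fun z => by linarith [(abs_le.1 (hlip z)).2]) x ht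
  have h2 := hu.super.neg.le_barrier hu.cont.neg (L := (L₀ : ℝ)) hC hK.le L₀.coe_nonneg
    (fun z s hs r p => (neg_le_abs _).trans (by simpa using hF z s hs (-r) (-p)))
    (fun z s hs => (neg_le_abs _).trans (hgrowth z s hs)) (c := -u₀ x) (y := x)
    (fun z => by linarith [(abs_le.1 (hlip z)).1]) x ht
  have h3 : C * (1 + L₀) * t ≤ C * (1 + L₀) * T :=
    mul_le_mul_of_nonneg_left ht.2.le (by positivity)
  simp only [hbr, mul_one] at h1 h2
  rw [abs_le]
  constructor <;> linarith

end Barrier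

section Doubling

variable {n : ℕ} {T : ℝ}

/-- The doubled function `u(x,t) - u(y,s)` with a weighted distance, a penalization at infinity,
a penalization in time and a penalization of `t ≠ s`. -/
noncomputable def penalizedDifference (u : EuclideanSpace ℝ (Fin n) → ℝ → ℝ) (W κ : ℝ → ℝ)
    (α m : ℝ) (P : (EuclideanSpace ℝ (Fin n) × ℝ) × (EuclideanSpace ℝ (Fin n) × ℝ)) : ℝ :=
  u P.1.1 P.1.2 - u P.2.1 P.2.2 - W P.1.2 * ‖P.1.1 - P.2.1‖ -
    α * (japaneseBracket P.1.1 + japaneseBracket P.2.1) - κ P.1.2 - m / 2 * (P.1.2 - P.2.2) ^ 2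

theorem le_half_sq_div_add {r s : ℝ} (hr : 0 < r) : s ≤ (s ^ 2 / r + r) / 2 := by
  have : (s ^ 2 / r + r) / 2 - s = (s - r) ^ 2 / (2 * r) := by
    field_simp
    ring
  have : 0 ≤ (s - r) ^ 2 / (2 * r) := by positivity
  linarith

theorem half_sq_div_add_self {r : ℝ} (hr : 0 < r) : (r ^ 2 / r + r) / 2 = r := by
  field_simp
  ring

theorem hasGradientAt_half_sq_div_add {V : Type*} [NormedAddCommGroup V] [InnerProductSpace ℝ V]
    [CompleteSpace V] (x y : V) (r : ℝ) :
    HasGradientAt (fun z => (‖z - y‖ ^ 2 / r + r) / 2) (r⁻¹ • (x - y)) x := by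
  have h1 : HasDerivAt (fun s : ℝ => (s / r + r) / 2) (1 / r / 2) (‖x - y‖ ^ 2) :=
    (((hasDerivAt_id (‖x - y‖ ^ 2)).div_const r).add_const r).div_const 2
  have h2 : r⁻¹ = 2 * (1 / r / 2) := by ring
  rw [h2]
  exact h1.hasGradientAt_norm_sub_sq

variable {F : EuclideanSpace ℝ (Fin n) → ℝ → ℝ → EuclideanSpace ℝ (Fin n) → ℝ}
  {u : EuclideanSpace ℝ (Fin n) → ℝ → ℝ} {W W' κ κ' : ℝ → ℝ} {T' α m : ℝ}

theorem IsViscositySubsolution.le_of_isMax_penalizedDifference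
    (hu : IsViscositySubsolution n T F u)
    (hW : ContDiff ℝ 1 W) (hW' : ∀ t, HasDerivAt W (W' t) t) (hWpos : ∀ t, 0 ≤ W t)
    (hκ : ContDiff ℝ 1 κ) (hκ' : ∀ t, HasDerivAt κ (κ' t) t)
    (hT' : T' < T) {x y : EuclideanSpace ℝ (Fin n)} {t s : ℝ} (ht : t ∈ Ioo 0 T')
    (hxy : x ≠ y)
    (hmax : ∀ z, ∀ r ∈ Icc 0 T', penalizedDifference u W κ α m ((z, r), (y, s)) ≤
      penalizedDifference u W κ α m ((x, t), (y, s))) :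
    W' t * ‖x - y‖ + κ' t + m * (t - s) ≤
      F x t (u x t) ((W t / ‖x - y‖) • (x - y) + α • ((japaneseBracket x)⁻¹ • x)) := by
  have hr : 0 < ‖x - y‖ := norm_pos_iff.2 (sub_ne_zero.2 hxy)
  set φ : EuclideanSpace ℝ (Fin n) → ℝ → ℝ := fun z r =>
    W r * ((‖z - y‖ ^ 2 / ‖x - y‖ + ‖x - y‖) / 2) + α * japaneseBracket z + κ r +
      m / 2 * (r - s) ^ 2 with hφ
  refine hu.le_of_local_max (φ := φ) ?_ ⟨ht.1, ht.2.trans hT'⟩ ?_ ?_ ?_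
  · have h1 : ContDiff ℝ 1 (fun P : EuclideanSpace ℝ (Fin n) × ℝ => ‖P.1 - y‖ ^ 2) :=
      (contDiff_fst.sub contDiff_const).norm_sq ℝ
    have h2 : ContDiff ℝ 1 (fun P : EuclideanSpace ℝ (Fin n) × ℝ => japaneseBracket P.1) :=
      contDiff_japaneseBracket.comp contDiff_fst
    simp only [hφ]
    fun_prop
  · have : ∀ᶠ P : EuclideanSpace ℝ (Fin n) × ℝ in 𝓝 (x, t), P.2 ∈ Icc 0 T' :=
      continuous_snd.continuousAt.eventually (Icc_mem_nhds ht.1 ht.2)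
    refine this.mono fun P hP => ?_
    have h1 := hmax P.1 P.2 hP
    have h2 := mul_le_mul_of_nonneg_left (le_half_sq_div_add (s := ‖P.1 - y‖) hr) (hWpos P.2)
    simp only [penalizedDifference] at h1
    simp only [hφ, half_sq_div_add_self hr]
    linarith
  · have h1 : HasDerivAt (fun r => m / 2 * (r - s) ^ 2) (m * (t - s)) t := by
      have := (((hasDerivAt_id t).sub_const s).pow 2).const_mul (m / 2)
      refine this.congr_deriv ?_
      simp
      ring
    have := ((((hW' t).mul_const ‖x - y‖).add_const (α * japaneseBracket x)).add (hκ' t)).add h1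
    simp only [hφ, half_sq_div_add_self hr]
    exact this
  · have h1 := hasGradientAt_half_sq_div_add x y ‖x - y‖
    have h2 := hasGradientAt_japaneseBracket_sub x 0
    simp only [sub_zero] at h2
    rw [hasGradientAt_iff_hasFDerivAt] at h1 h2 ⊢
    have := (((h1.const_mul (W t)).add (h2.const_mul α)).add_const (κ t)).add_const
      (m / 2 * (t - s) ^ 2)
    refine this.congr_fderiv ?_
    simp only [map_add, map_smul, smul_smul, div_eq_mul_inv]

theorem IsViscositySupersolution.le_of_isMax_penalizedDifference
    (hu : IsViscositySupersolution n T F u) (hWpos : ∀ t, 0 ≤ W t)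
    (hT' : T' < T) {x y : EuclideanSpace ℝ (Fin n)} {t s : ℝ} (hs : s ∈ Ioo 0 T')
    (hxy : x ≠ y)
    (hmax : ∀ z, ∀ r ∈ Icc 0 T', penalizedDifference u W κ α m ((x, t), (z, r)) ≤
      penalizedDifference u W κ α m ((x, t), (y, s))) :
    F y s (u y s) ((W t / ‖x - y‖) • (x - y) - α • ((japaneseBracket y)⁻¹ • y)) ≤ m * (t - s) := by
  have hr : 0 < ‖y - x‖ := norm_pos_iff.2 (sub_ne_zero.2 hxy.symm)
  set φ : EuclideanSpace ℝ (Fin n) → ℝ → ℝ := fun z r =>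
    W t * ((‖z - x‖ ^ 2 / ‖y - x‖ + ‖y - x‖) / 2) + α * japaneseBracket z +
      m / 2 * (r - t) ^ 2 with hφ
  have key := hu.neg.le_of_local_max (φ := φ) (x₀ := y) (t₀ := s) (a := m * (s - t))
    (g := (W t / ‖y - x‖) • (y - x) + α • ((japaneseBracket y)⁻¹ • y)) ?_
    ⟨hs.1, hs.2.trans hT'⟩ ?_ ?_ ?_
  · have h1 : -((W t / ‖y - x‖) • (y - x) + α • ((japaneseBracket y)⁻¹ • y)) =
        (W t / ‖x - y‖) • (x - y) - α • ((japaneseBracket y)⁻¹ • y) := by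
      rw [norm_sub_rev, neg_add, ← smul_neg, neg_sub, ← sub_eq_add_neg]
    rw [h1, neg_neg] at key
    linarith
  · have h1 : ContDiff ℝ 1 (fun P : EuclideanSpace ℝ (Fin n) × ℝ => ‖P.1 - x‖ ^ 2) :=
      (contDiff_fst.sub contDiff_const).norm_sq ℝ
    have h2 : ContDiff ℝ 1 (fun P : EuclideanSpace ℝ (Fin n) × ℝ => japaneseBracket P.1) :=
      contDiff_japaneseBracket.comp contDiff_fst
    simp only [hφ]
    fun_prop
  · have : ∀ᶠ P : EuclideanSpace ℝ (Fin n) × ℝ in 𝓝 (y, s), P.2 ∈ Icc 0 T' :=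
      continuous_snd.continuousAt.eventually (Icc_mem_nhds hs.1 hs.2)
    refine this.mono fun P hP => ?_
    have h1 := hmax P.1 P.2 hP
    have h2 := mul_le_mul_of_nonneg_left (le_half_sq_div_add (s := ‖P.1 - x‖) hr) (hWpos t)
    simp only [penalizedDifference, norm_sub_rev x] at h1
    simp only [hφ, half_sq_div_add_self hr]
    linarith [show m / 2 * (P.2 - t) ^ 2 = m / 2 * (t - P.2) ^ 2 by ring,
      show m / 2 * (s - t) ^ 2 = m / 2 * (t - s) ^ 2 by ring]
  · have h1 : HasDerivAt (fun r => m / 2 * (r - t) ^ 2) (m * (s - t)) s := by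
      have := (((hasDerivAt_id s).sub_const t).pow 2).const_mul (m / 2)
      refine this.congr_deriv ?_
      simp
      ring
    exact h1.const_add _
  · have h1 := hasGradientAt_half_sq_div_add y x ‖y - x‖
    have h2 := hasGradientAt_japaneseBracket_sub y 0
    simp only [sub_zero] at h2
    rw [hasGradientAt_iff_hasFDerivAt] at h1 h2 ⊢
    have := ((h1.const_mul (W t)).add (h2.const_mul α)).add_const (m / 2 * (s - t) ^ 2)
    refine this.congr_fderiv ?_
    simp only [map_add, map_smul, smul_smul, div_eq_mul_inv]

theorem exists_doubling_inequality
    (hsub : IsViscositySubsolution n T F u) (hsuper : IsViscositySupersolution n T F u)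
    (hcont : ContinuousOn (fun P : EuclideanSpace ℝ (Fin n) × ℝ => u P.1 P.2) (univ ×ˢ Ico 0 T))
    (hF : ContinuousOn
      (fun q : EuclideanSpace ℝ (Fin n) × ℝ × ℝ × EuclideanSpace ℝ (Fin n) =>
        F q.1 q.2.1 q.2.2.1 q.2.2.2) (univ ×ˢ (Icc 0 T ×ˢ univ)))
    (hW : ContDiff ℝ 1 W) (hW' : ∀ t, HasDerivAt W (W' t) t) (hWpos : ∀ t, 0 ≤ W t)
    (hκ : ContDiff ℝ 1 κ) (hκ' : ∀ t, HasDerivAt κ (κ' t) t) (hκpos : ∀ t, 0 ≤ κ t)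
    (hT' : T' < T) (hα : 0 < α) {B : ℝ}
    (hbound : ∀ x y, ∀ t ∈ Icc 0 T', ∀ s ∈ Icc 0 T', u x t - u y s - W t * ‖x - y‖ ≤ B)
    (hinit : ∀ x y, u x 0 - u y 0 ≤ W 0 * ‖x - y‖) (hκT' : B ≤ κ T')
    {x₁ y₁ : EuclideanSpace ℝ (Fin n)} {t₁ : ℝ} (ht₁ : t₁ ∈ Icc 0 T')
    (hpos : 0 < u x₁ t₁ - u y₁ t₁ - W t₁ * ‖x₁ - y₁‖ -
      α * (japaneseBracket x₁ + japaneseBracket y₁) - κ t₁) :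
    ∃ x y, ∃ t ∈ Ioo 0 T', x ≠ y ∧ u y t ≤ u x t ∧
      W' t * ‖x - y‖ + κ' t ≤
        F x t (u x t) ((W t / ‖x - y‖) • (x - y) + α • ((japaneseBracket x)⁻¹ • x)) -
        F y t (u y t) ((W t / ‖x - y‖) • (x - y) - α • ((japaneseBracket y)⁻¹ • y)) := by
  set c := u x₁ t₁ - u y₁ t₁ - W t₁ * ‖x₁ - y₁‖ -
      α * (japaneseBracket x₁ + japaneseBracket y₁) - κ t₁ with hc
  set K : Set ((EuclideanSpace ℝ (Fin n) × ℝ) × (EuclideanSpace ℝ (Fin n) × ℝ)) :=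
    (Metric.closedBall 0 (B / α) ×ˢ Icc 0 T') ×ˢ (Metric.closedBall 0 (B / α) ×ˢ Icc 0 T') with hK
  set S : Set ((EuclideanSpace ℝ (Fin n) × ℝ) × (EuclideanSpace ℝ (Fin n) × ℝ)) :=
    (univ ×ˢ Icc 0 T') ×ˢ (univ ×ˢ Icc 0 T') with hS
  have hKc : IsCompact K :=
    ((isCompact_closedBall _ _).prod isCompact_Icc).prod
      ((isCompact_closedBall _ _).prod isCompact_Icc)
  have hKS : K ⊆ S := prod_mono (prod_mono (subset_univ _) subset_rfl)
    (prod_mono (subset_univ _) subset_rfl)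
  have hucont : ContinuousOn (fun P : EuclideanSpace ℝ (Fin n) × ℝ => u P.1 P.2)
      (univ ×ˢ Icc 0 T') := hcont.mono (prod_mono subset_rfl (Icc_subset_Ico_right hT'))
  have hu1 : ContinuousOn (fun P : (EuclideanSpace ℝ (Fin n) × ℝ) ×
      (EuclideanSpace ℝ (Fin n) × ℝ) => u P.1.1 P.1.2) S :=
    hucont.comp continuousOn_fst fun P hP => hP.1
  have hu2 : ContinuousOn (fun P : (EuclideanSpace ℝ (Fin n) × ℝ) ×
      (EuclideanSpace ℝ (Fin n) × ℝ) => u P.2.1 P.2.2) S :=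
    hucont.comp continuousOn_snd fun P hP => hP.2
  have hWc := hW.continuous
  have hκc := hκ.continuous
  have hψc := continuous_japaneseBracket (V := EuclideanSpace ℝ (Fin n))
  have hΦc : ∀ m, ContinuousOn (penalizedDifference u W κ α m) S := by
    intro m
    have h : Continuous fun P : (EuclideanSpace ℝ (Fin n) × ℝ) × (EuclideanSpace ℝ (Fin n) × ℝ) =>
        W P.1.2 * ‖P.1.1 - P.2.1‖ + α * (japaneseBracket P.1.1 + japaneseBracket P.2.1) + κ P.1.2 +
          m / 2 * (P.1.2 - P.2.2) ^ 2 := by fun_prop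
    refine ((hu1.sub hu2).sub h.continuousOn).congr fun P _ => ?_
    simp only [penalizedDifference, Pi.sub_apply]
    ring
  have hmem₁ : ((x₁, t₁), (y₁, t₁)) ∈ S := ⟨⟨mem_univ _, ht₁⟩, ⟨mem_univ _, ht₁⟩⟩
  have hval : ∀ m, penalizedDifference u W κ α m ((x₁, t₁), (y₁, t₁)) = c := by
    intro m
    simp [penalizedDifference, hc]
  have hmono : ∀ m : ℕ, ∀ P ∈ S, c ≤ penalizedDifference u W κ α m P →
      (m : ℝ) / 2 * (P.1.2 - P.2.2) ^ 2 ≤ B ∧ c ≤ penalizedDifference u W κ α 0 P ∧ P ∈ K := by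
    rintro m ⟨⟨x, t⟩, ⟨y, s⟩⟩ ⟨⟨-, ht⟩, ⟨-, hs⟩⟩ hle
    simp only [penalizedDifference] at hle ht hs ⊢
    have h1 := hbound x y t ht s hs
    have h2 : 0 ≤ (m : ℝ) / 2 * (t - s) ^ 2 := by positivity
    have h3 := hκpos t
    have h4 : α * ‖x‖ ≤ α * japaneseBracket x := by gcongr; exact norm_le_japaneseBracket _
    have h5 : α * ‖y‖ ≤ α * japaneseBracket y := by gcongr; exact norm_le_japaneseBracket _
    have h6 : 0 ≤ α * ‖x‖ := by positivity
    have h7 : 0 ≤ α * ‖y‖ := by positivity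
    refine ⟨by linarith, by linarith, ⟨?_, ht⟩, ⟨?_, hs⟩⟩ <;>
      · rw [mem_closedBall_zero_iff, le_div_iff₀ hα]
        linarith
  have hex : ∀ m : ℕ, ∃ z ∈ K, ∀ w ∈ S,
      penalizedDifference u W κ α m w ≤ penalizedDifference u W κ α m z := fun m =>
    (hΦc m).exists_isMaxOn_of_superlevel_subset hKc hKS hmem₁
      fun P hP hle => (hmono m P hP (by rwa [hval] at hle)).2.2
  choose z hzK hzmax using hex
  have hzS : ∀ m : ℕ, z m ∈ S := fun m => hKS (hzK m)
  have hzc : ∀ m : ℕ, c ≤ penalizedDifference u W κ α m (z m) := fun m =>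
    hval m ▸ hzmax m _ hmem₁
  obtain ⟨⟨⟨x, t⟩, ⟨y, s⟩⟩, hlimK, σ, hσ, hlim⟩ := hKc.tendsto_subseq hzK
  have hlimS := hKS hlimK
  have hx : Tendsto (fun j => (z (σ j)).1.1) atTop (𝓝 x) :=
    (continuous_fst.fst.tendsto _).comp hlim
  have ht : Tendsto (fun j => (z (σ j)).1.2) atTop (𝓝 t) :=
    (continuous_fst.snd.tendsto _).comp hlim
  have hy : Tendsto (fun j => (z (σ j)).2.1) atTop (𝓝 y) :=
    (continuous_snd.fst.tendsto _).comp hlim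
  have hs : Tendsto (fun j => (z (σ j)).2.2) atTop (𝓝 s) :=
    (continuous_snd.snd.tendsto _).comp hlim
  have hlimW : Tendsto (fun j => z (σ j)) atTop (𝓝[S] ((x, t), (y, s))) :=
    tendsto_nhdsWithin_iff.2 ⟨hlim, Eventually.of_forall fun j => hzS _⟩
  have hts : t = s := by
    have h1 : Tendsto (fun j => ((z (σ j)).1.2 - (z (σ j)).2.2) ^ 2) atTop (𝓝 ((t - s) ^ 2)) :=
      (ht.sub hs).pow 2
    have h2 : Tendsto (fun j : ℕ => 2 * B / (σ j : ℝ)) atTop (𝓝 0) :=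
      (tendsto_const_nhds.div_atTop tendsto_natCast_atTop_atTop).comp hσ.tendsto_atTop
    have h3 : (t - s) ^ 2 ≤ 0 := by
      refine le_of_tendsto_of_tendsto h1 h2 ?_
      filter_upwards [eventually_gt_atTop 0] with j hj
      have h4 : 0 < (σ j : ℝ) := by exact_mod_cast hj.trans_le (hσ.id_le j)
      have := (hmono _ _ (hzS (σ j)) (hzc _)).1
      rw [le_div_iff₀ h4]
      linarith
    exact sub_eq_zero.1 (pow_eq_zero_iff two_ne_zero |>.1 (le_antisymm h3 (sq_nonneg _)))
  subst hts
  have hlimc : c ≤ penalizedDifference u W κ α 0 ((x, t), (y, t)) :=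
    ge_of_tendsto ((hΦc 0 _ hlimS).tendsto.comp hlimW)
      (Eventually.of_forall fun j => (hmono _ _ (hzS (σ j)) (hzc _)).2.1)
  have htI : t ∈ Icc 0 T' := hlimS.1.2
  simp only [penalizedDifference, sub_self] at hlimc
  have hψx := mul_pos hα (japaneseBracket_pos x)
  have hψy := mul_pos hα (japaneseBracket_pos y)
  have hxy : x ≠ y := by
    rintro rfl
    have := hκpos t
    simp only [sub_self, norm_zero, mul_zero] at hlimc
    linarith
  have ht0 : 0 < t := by
    rcases htI.1.eq_or_lt with rfl | h
    · have := hκpos 0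
      have := hinit x y
      linarith
    · exact h
  have htT' : t < T' := by
    rcases htI.2.eq_or_lt with rfl | h
    · have := hbound x y t htI t htI
      linarith
    · exact h
  have hev : ∀ᶠ j in atTop, W' (z (σ j)).1.2 * ‖(z (σ j)).1.1 - (z (σ j)).2.1‖ + κ' (z (σ j)).1.2 ≤
      F (z (σ j)).1.1 (z (σ j)).1.2 (u (z (σ j)).1.1 (z (σ j)).1.2)
        ((W (z (σ j)).1.2 / ‖(z (σ j)).1.1 - (z (σ j)).2.1‖) • ((z (σ j)).1.1 - (z (σ j)).2.1) +
          α • ((japaneseBracket (z (σ j)).1.1)⁻¹ • (z (σ j)).1.1)) -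
      F (z (σ j)).2.1 (z (σ j)).2.2 (u (z (σ j)).2.1 (z (σ j)).2.2)
        ((W (z (σ j)).1.2 / ‖(z (σ j)).1.1 - (z (σ j)).2.1‖) • ((z (σ j)).1.1 - (z (σ j)).2.1) -
          α • ((japaneseBracket (z (σ j)).2.1)⁻¹ • (z (σ j)).2.1)) := by
    filter_upwards [ht.eventually (Ioo_mem_nhds ht0 htT'), hs.eventually (Ioo_mem_nhds ht0 htT'),
      (hx.sub hy).eventually_ne (sub_ne_zero.2 hxy)] with j hj1 hj2 hj3
    have h1 := hsub.le_of_isMax_penalizedDifference (α := α) (m := (σ j : ℕ)) hW hW' hWpos hκ hκ'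
      hT' hj1 (sub_ne_zero.1 hj3)
      fun w r hr => hzmax (σ j) ((w, r), (z (σ j)).2) ⟨⟨mem_univ _, hr⟩, (hzS (σ j)).2⟩
    have h2 := hsuper.le_of_isMax_penalizedDifference (κ := κ) (α := α) (m := (σ j : ℕ)) hWpos hT'
      (t := (z (σ j)).1.2) hj2 (sub_ne_zero.1 hj3)
      fun w r hr => hzmax (σ j) ((z (σ j)).1, (w, r)) ⟨(hzS (σ j)).1, ⟨mem_univ _, hr⟩⟩
    linarith
  refine ⟨x, y, t, ⟨ht0, htT'⟩, hxy, ?_, ?_⟩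
  · have := hκpos t
    have := mul_nonneg (hWpos t) (norm_nonneg (x - y))
    linarith
  have hr : Tendsto (fun j => ‖(z (σ j)).1.1 - (z (σ j)).2.1‖) atTop (𝓝 ‖x - y‖) :=
    (hx.sub hy).norm
  have hW'c : Continuous W' := by
    have : W' = deriv W := funext fun t => (hW' t).deriv.symm
    exact this ▸ hW.continuous_deriv le_rfl
  have hκ'c : Continuous κ' := by
    have : κ' = deriv κ := funext fun t => (hκ' t).deriv.symm
    exact this ▸ hκ.continuous_deriv le_rfl
  have hWt : Tendsto (fun j => W (z (σ j)).1.2) atTop (𝓝 (W t)) := (hWc.tendsto _).comp ht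
  have hp : Tendsto (fun j => (W (z (σ j)).1.2 / ‖(z (σ j)).1.1 - (z (σ j)).2.1‖) •
      ((z (σ j)).1.1 - (z (σ j)).2.1)) atTop (𝓝 ((W t / ‖x - y‖) • (x - y))) :=
    (hWt.div hr (norm_ne_zero_iff.2 (sub_ne_zero.2 hxy))).smul (hx.sub hy)
  have hq : Continuous fun w : EuclideanSpace ℝ (Fin n) => α • ((japaneseBracket w)⁻¹ • w) := by
    exact ((hψc.fun_inv₀ fun w => (japaneseBracket_pos w).ne').smul continuous_id).const_smul α
  have htT : t ∈ Icc 0 T := ⟨ht0.le, htT'.le.trans hT'.le⟩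
  have hsubT : Icc 0 T' ⊆ Icc 0 T := Icc_subset_Icc_right hT'.le
  refine le_of_tendsto_of_tendsto
    ((((hW'c.tendsto _).comp ht).mul hr).add ((hκ'c.tendsto _).comp ht)) (Tendsto.sub ?_ ?_) hev
  · refine (hF (x, t, u x t, _) ⟨mem_univ _, htT, mem_univ _⟩).tendsto.comp
      (tendsto_nhdsWithin_iff.2 ⟨hx.prodMk_nhds (ht.prodMk_nhds
        (((hu1 _ hlimS).tendsto.comp hlimW).prodMk_nhds (hp.add ((hq.tendsto _).comp hx)))),
        Eventually.of_forall fun j => ⟨mem_univ _, hsubT (hzS (σ j)).1.2, mem_univ _⟩⟩)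
  · refine (hF (y, t, u y t, _) ⟨mem_univ _, htT, mem_univ _⟩).tendsto.comp
      (tendsto_nhdsWithin_iff.2 ⟨hy.prodMk_nhds (hs.prodMk_nhds
        (((hu2 _ hlimS).tendsto.comp hlimW).prodMk_nhds (hp.sub ((hq.tendsto _).comp hy)))),
        Eventually.of_forall fun j => ⟨mem_univ _, hsubT (hzS (σ j)).2.2, mem_univ _⟩⟩)

end Doubling

theorem nonpos_of_one_lt_norm {n : ℕ} {h : EuclideanSpace ℝ (Fin n) → ℝ}
    (hsign : ChangesSignAtUnitSphere n h ∨ VanishesOutsideUnitBall n h)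
    {p : EuclideanSpace ℝ (Fin n)} (hp : 1 < ‖p‖) : h p ≤ 0 :=
  hsign.elim (fun H => (H.2 p hp).le) fun H => (H.2 p hp.le).le

theorem exists_abs_hamiltonian_le {n : ℕ} {T : ℝ}
    {H₁ : EuclideanSpace ℝ (Fin n) → ℝ → EuclideanSpace ℝ (Fin n) → ℝ}
    (hH₁ : IsGeometricHamiltonian n T H₁) {β : ℝ → ℝ} (hβ : IsSignLike β)
    {h : EuclideanSpace ℝ (Fin n) → ℝ} (hh : HasModulus n h) {θ : ℝ} (hθ : 0 < θ) :
    ∃ C ≥ 0, ∀ x, ∀ t ∈ Ioo 0 T, ∀ r p, |H₁ x t p + θ * (β r * h p)| ≤ C * (1 + ‖p‖) := by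
  obtain ⟨L, hL, hLb⟩ := hH₁.linear_growth
  obtain ⟨A, hA, hAb⟩ := hh.linear_growth
  obtain ⟨M, hM⟩ := hβ.bdd
  have hM0 : 0 ≤ M := (abs_nonneg _).trans (hM 0)
  refine ⟨L + θ * (M * A), by positivity, fun x t ht r p => ?_⟩
  have h1 := hLb x t (Ioo_subset_Icc_self ht) p
  have h2 : |θ * (β r * h p)| ≤ θ * (M * (A * (1 + ‖p‖))) := by
    rw [abs_mul, abs_mul, abs_of_pos hθ]
    gcongr
    exacts [hM r, hAb p]
  have := abs_add_le (H₁ x t p) (θ * (β r * h p))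
  linarith

theorem continuousOn_hamiltonian {n : ℕ} {T : ℝ}
    {H₁ : EuclideanSpace ℝ (Fin n) → ℝ → EuclideanSpace ℝ (Fin n) → ℝ}
    (hH₁ : IsGeometricHamiltonian n T H₁) {β : ℝ → ℝ} (hβ : IsSignLike β)
    {h : EuclideanSpace ℝ (Fin n) → ℝ} (hh : HasModulus n h) (θ : ℝ) :
    ContinuousOn (fun q : EuclideanSpace ℝ (Fin n) × ℝ × ℝ × EuclideanSpace ℝ (Fin n) =>
      H₁ q.1 q.2.1 q.2.2.2 + θ * (β q.2.2.1 * h q.2.2.2)) (univ ×ˢ (Icc 0 T ×ˢ univ)) := by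
  obtain ⟨Lβ, hLβ⟩ := hβ.lip
  have h1 := hLβ.continuous
  have h2 := hh.continuous
  have h3 : ContinuousOn (fun q : EuclideanSpace ℝ (Fin n) × ℝ × ℝ × EuclideanSpace ℝ (Fin n) =>
      H₁ q.1 q.2.1 q.2.2.2) (univ ×ˢ (Icc 0 T ×ˢ univ)) :=
    hH₁.cont.comp
      (f := fun q : EuclideanSpace ℝ (Fin n) × ℝ × ℝ × EuclideanSpace ℝ (Fin n) =>
        (q.1, q.2.1, q.2.2.2)) (by fun_prop) fun q hq => ⟨mem_univ _, hq.2.1, mem_univ _⟩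
  refine h3.add (Continuous.continuousOn ?_)
  fun_prop

/-- The difference of the Hamiltonians at two points, with nearby gradients longer than `1`,
is controlled by the Lipschitz constant of `H₁` in space. -/
theorem hamiltonian_sub_le {n : ℕ} {T : ℝ}
    {H₁ : EuclideanSpace ℝ (Fin n) → ℝ → EuclideanSpace ℝ (Fin n) → ℝ}
    (hH₁ : IsGeometricHamiltonian n T H₁) {D : ℝ → ℝ} (hD : IsLipschitzInSpace n T H₁ D)
    {β : ℝ → ℝ} (hβ : IsSignLike β) {h : EuclideanSpace ℝ (Fin n) → ℝ}
    (hsign : ChangesSignAtUnitSphere n h ∨ VanishesOutsideUnitBall n h)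
    {θ : ℝ} (hθ : 0 < θ) {L₂ M : ℝ} (hL₂ : 0 ≤ L₂)
    (hlip : ∀ x, ∀ t ∈ Icc 0 T, ∀ p q, |H₁ x t p - H₁ x t q| ≤ L₂ * ‖p - q‖)
    (hM : ∀ r, |β r| ≤ M) {ω : ℝ≥0 → ℝ≥0} (hω : Monotone ω)
    (hhω : ∀ p q, |h p - h q| ≤ ω ‖p - q‖₊)
    {x y a b : EuclideanSpace ℝ (Fin n)} (hxy : x ≠ y) {t w α r s : ℝ} (ht : t ∈ Icc 0 T)
    (hα : 0 ≤ α) (hw : 1 + α < w) (hsr : s ≤ r) (ha : ‖a‖ ≤ 1) (hb : ‖b‖ ≤ 1) :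
    (H₁ x t ((w / ‖x - y‖) • (x - y) + α • a) +
        θ * (β r * h ((w / ‖x - y‖) • (x - y) + α • a))) -
      (H₁ y t ((w / ‖x - y‖) • (x - y) - α • b) +
        θ * (β s * h ((w / ‖x - y‖) • (x - y) - α • b))) ≤
    w * D t * ‖x - y‖ + (2 * L₂ * α + θ * (M * ω (2 * α).toNNReal)) := by
  have hr : 0 < ‖x - y‖ := norm_pos_iff.2 (sub_ne_zero.2 hxy)
  have hw0 : 0 < w := by linarith
  set e := ‖x - y‖⁻¹ • (x - y) with he
  have hep : (w / ‖x - y‖) • (x - y) = w • e := by rw [he, smul_smul, div_eq_mul_inv]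
  have he1 : ‖e‖ = 1 := by rw [he, norm_smul, norm_inv, norm_norm, inv_mul_cancel₀ hr.ne']
  have hwe : ‖w • e‖ = w := by rw [norm_smul, he1, mul_one, Real.norm_of_nonneg hw0.le]
  rw [hep]
  have hαa : ‖α • a‖ ≤ α := by
    rw [norm_smul, Real.norm_of_nonneg hα]; exact mul_le_of_le_one_right hα ha
  have hαb : ‖α • b‖ ≤ α := by
    rw [norm_smul, Real.norm_of_nonneg hα]; exact mul_le_of_le_one_right hα hb
  set p := w • e + α • a with hp
  set q := w • e - α • b with hq
  have hp1 : 1 < ‖p‖ := by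
    have := norm_sub_le_norm_add (w • e) (α • a)
    linarith
  have h1 : H₁ x t p - H₁ x t (w • e) ≤ L₂ * α := by
    refine (le_abs_self _).trans ((hlip x t ht _ _).trans ?_)
    rw [hp, add_sub_cancel_left]
    gcongr
  have h2 : H₁ y t (w • e) - H₁ y t q ≤ L₂ * α := by
    refine (le_abs_self _).trans ((hlip y t ht _ _).trans ?_)
    rw [hq, sub_sub_cancel]
    gcongr
  have h3 : H₁ x t (w • e) - H₁ y t (w • e) ≤ w * D t * ‖x - y‖ := by
    rw [hH₁.homog w hw0 x t ht, hH₁.homog w hw0 y t ht, ← mul_sub, mul_assoc]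
    gcongr
    exact (le_abs_self _).trans (hD.lip x y t ht e he1)
  have h4 : (β r - β s) * h p ≤ 0 :=
    mul_nonpos_of_nonneg_of_nonpos (sub_nonneg.2 (hβ.mono hsr))
      (nonpos_of_one_lt_norm hsign hp1)
  have h5 : |h p - h q| ≤ ω (2 * α).toNNReal := by
    refine (hhω p q).trans (NNReal.coe_le_coe.2 (hω ?_))
    rw [← NNReal.coe_le_coe, coe_nnnorm, Real.coe_toNNReal _ (by positivity)]
    have : p - q = α • a + α • b := by rw [hp, hq]; abel
    rw [this]
    linarith [norm_add_le (α • a) (α • b)]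
  have h6 : β s * (h p - h q) ≤ M * ω (2 * α).toNNReal := by
    refine (le_abs_self _).trans ?_
    rw [abs_mul]
    have := (abs_nonneg _).trans (hM s)
    gcongr
    exact hM s
  have h7 : θ * (β r * h p) - θ * (β s * h q) ≤ θ * (M * ω (2 * α).toNNReal) := by
    rw [← mul_sub]
    gcongr
    linarith
  linarith

theorem IsCauchySolution.sub_le_mul_norm_sub {n : ℕ} {T : ℝ} (hT : 0 < T)
    {H₁ : EuclideanSpace ℝ (Fin n) → ℝ → EuclideanSpace ℝ (Fin n) → ℝ}
    (hH₁ : IsGeometricHamiltonian n T H₁) {D : ℝ → ℝ} (hD : IsLipschitzInSpace n T H₁ D)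
    {β : ℝ → ℝ} (hβ : IsSignLike β)
    {h : EuclideanSpace ℝ (Fin n) → ℝ} (hh : HasModulus n h)
    (hsign : ChangesSignAtUnitSphere n h ∨ VanishesOutsideUnitBall n h)
    {u₀ : EuclideanSpace ℝ (Fin n) → ℝ} {L₀ : ℝ≥0} (hu₀ : LipschitzWith L₀ u₀)
    {θ : ℝ} (hθ : 0 < θ) {u : EuclideanSpace ℝ (Fin n) → ℝ → ℝ}
    (hu : IsCauchySolution n T (fun x t r p => H₁ x t p + θ * (β r * h p)) u₀ u)
    {N : ℝ} (hN1 : 1 < N) (hNL : (L₀ : ℝ) ≤ N)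
    (x₁ y₁ : EuclideanSpace ℝ (Fin n)) {t₁ : ℝ} (ht₁ : t₁ ∈ Ico 0 T) :
    u x₁ t₁ - u y₁ t₁ ≤ N * Real.exp (∫ s in (0 : ℝ)..t₁, D s) * ‖x₁ - y₁‖ := by
  rcases eq_or_ne x₁ y₁ with rfl | hxy₁
  · simp
  have hr₁ : 0 < ‖x₁ - y₁‖ := norm_pos_iff.2 (sub_ne_zero.2 hxy₁)
  have hlip₀ : ∀ x y, u₀ x - u₀ y ≤ L₀ * ‖x - y‖ := fun x y => by
    refine (le_abs_self _).trans ?_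
    rw [← Real.norm_eq_abs, ← dist_eq_norm, ← dist_eq_norm]
    exact hu₀.dist_le_mul x y
  have hD0 : ∀ t ∈ Icc 0 T, 0 ≤ D t := fun t ht => by
    have h1 := (abs_nonneg _).trans (hD.lip x₁ y₁ t ht (‖x₁ - y₁‖⁻¹ • (x₁ - y₁))
      (by rw [norm_smul, norm_inv, norm_norm, inv_mul_cancel₀ hr₁.ne']))
    exact nonneg_of_mul_nonneg_left h1 hr₁
  set D' : ℝ → ℝ := IccExtend hT.le ((Icc 0 T).domRestrict D) with hD'
  have hD'c : Continuous D' := hD.cont.domRestrict.Icc_extend'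
  have hD'D : ∀ t ∈ Icc 0 T, D' t = D t := fun t ht => IccExtend_of_mem hT.le _ ht
  have hD'0 : ∀ t, 0 ≤ D' t := fun t => hD0 _ (projIcc 0 T hT.le t).2
  set W : ℝ → ℝ := fun t => N * Real.exp (∫ s in (0 : ℝ)..t, D' s) with hWdef
  have hW' : ∀ t, HasDerivAt W (W t * D' t) t := fun t => by
    have := ((hD'c.integral_hasStrictDerivAt 0 t).hasDerivAt.exp).const_mul N
    refine this.congr_deriv ?_
    rw [hWdef, mul_assoc]
  have hWc : Continuous W := continuous_iff_continuousAt.2 fun t => (hW' t).continuousAt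
  have hW : ContDiff ℝ 1 W := by
    rw [contDiff_one_iff_deriv]
    refine ⟨fun t => (hW' t).differentiableAt, ?_⟩
    rw [show deriv W = fun t => W t * D' t from funext fun t => (hW' t).deriv]
    exact hWc.mul hD'c
  have hN0 : 0 < N := by linarith
  have hWpos : ∀ t, 0 ≤ W t := fun t => by positivity
  have hWN : ∀ t, 0 ≤ t → N ≤ W t := fun t ht =>
    le_mul_of_one_le_right hN0.le (Real.one_le_exp
      (intervalIntegral.integral_nonneg ht fun s _ => hD'0 s))
  have hW₁ : W t₁ = N * Real.exp (∫ s in (0 : ℝ)..t₁, D s) := by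
    simp only [hWdef]
    congr 2
    refine intervalIntegral.integral_congr fun s hs => ?_
    rw [uIcc_of_le ht₁.1] at hs
    exact hD'D s ⟨hs.1, hs.2.trans ht₁.2.le⟩
  rw [← hW₁]
  have hinit : ∀ x y, u x 0 - u y 0 ≤ W 0 * ‖x - y‖ := fun x y => by
    rw [hu.init, hu.init]
    refine (hlip₀ x y).trans ?_
    gcongr
    exact hNL.trans (hWN 0 le_rfl)
  obtain ⟨C, hC, hCb⟩ := exists_abs_hamiltonian_le hH₁ hβ hh hθ
  set B := 2 * (L₀ + C * (1 + L₀) * T) with hB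
  have hbound : ∀ x y, ∀ t ∈ Ico 0 T, ∀ s ∈ Ico 0 T, u x t - u y s - W t * ‖x - y‖ ≤ B := by
    intro x y t ht s hs
    have h1 := (abs_le.1 (hu.abs_sub_initial_le hu₀ hC hCb x ht)).2
    have h2 := (abs_le.1 (hu.abs_sub_initial_le hu₀ hC hCb y hs)).1
    have h3 := hlip₀ x y
    have h4 : L₀ * ‖x - y‖ ≤ W t * ‖x - y‖ := by
      gcongr
      exact hNL.trans (hWN t ht.1)
    linarith
  by_contra! hlt
  set δ := u x₁ t₁ - u y₁ t₁ - W t₁ * ‖x₁ - y₁‖ with hδ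
  have hδ0 : 0 < δ := by linarith
  obtain ⟨T', ht₁T', hT'T⟩ := exists_between ht₁.2
  obtain ⟨k, hk, hkB⟩ := exists_lt_mul_exp B (show 0 < δ / 3 by linarith) (sub_pos.2 ht₁T')
  set κ : ℝ → ℝ := fun t => δ / 3 * Real.exp (k * (t - t₁)) with hκdef
  have hκ' : ∀ t, HasDerivAt κ (δ / 3 * (Real.exp (k * (t - t₁)) * k)) t := fun t => by
    have h2 : HasDerivAt (fun t => Real.exp (k * (t - t₁))) (Real.exp (k * (t - t₁)) * k) t := by
      simpa using (((hasDerivAt_id t).sub_const t₁).const_mul k).exp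
    exact h2.const_mul _
  have hκ : ContDiff ℝ 1 κ := by
    simp only [hκdef]
    fun_prop
  set σ := δ / 3 * (Real.exp (k * (0 - t₁)) * k) with hσ
  have hσ0 : 0 < σ := by positivity
  obtain ⟨L₂, hL₂, hlip⟩ := hH₁.lip_p
  obtain ⟨M, hM⟩ := hβ.bdd
  obtain ⟨ω, hω, hhω⟩ := hh
  have hlim : Tendsto (fun α : ℝ => 2 * L₂ * α + θ * (M * ω (2 * α).toNNReal)) (𝓝 0) (𝓝 0) := by
    have h1 : Tendsto (fun α : ℝ => (2 * α).toNNReal) (𝓝 0) (𝓝 0) := by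
      have : Continuous fun α : ℝ => (2 * α).toNNReal := by fun_prop
      simpa using this.tendsto 0
    have h2 : Tendsto (fun α : ℝ => ((ω (2 * α).toNNReal : ℝ≥0) : ℝ)) (𝓝 0) (𝓝 0) := by
      rw [← NNReal.coe_zero, NNReal.tendsto_coe]
      exact hω.tendsto.comp h1
    simpa using (tendsto_id.const_mul (2 * L₂)).add ((h2.const_mul M).const_mul θ)
  have hlim2 : Tendsto (fun α : ℝ => α * (japaneseBracket x₁ + japaneseBracket y₁)) (𝓝 0) (𝓝 0) := by
    simpa using (tendsto_id (x := 𝓝 (0 : ℝ))).mul_const (japaneseBracket x₁ + japaneseBracket y₁)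
  have hev : ∀ᶠ α : ℝ in 𝓝 0, 2 * L₂ * α + θ * (M * ω (2 * α).toNNReal) < σ ∧
      α * (japaneseBracket x₁ + japaneseBracket y₁) < δ / 3 ∧ α < N - 1 :=
    (hlim.eventually_lt_const hσ0).and
      ((hlim2.eventually_lt_const (by linarith)).and (eventually_lt_nhds (by linarith)))
  obtain ⟨α, ⟨hα1, hα2, hα3⟩, hα0⟩ :=
    ((hev.filter_mono nhdsWithin_le_nhds).and (self_mem_nhdsWithin (s := Ioi (0 : ℝ)))).exists
  have hα0 : 0 < α := hα0
  have hsubT : Icc 0 T' ⊆ Ico 0 T := Icc_subset_Ico_right hT'T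
  obtain ⟨x, y, t, ht, hxy, huv, hineq⟩ := exists_doubling_inequality (α := α) (B := B)
    hu.sub hu.super hu.cont (continuousOn_hamiltonian hH₁ hβ ⟨ω, hω, hhω⟩ θ) hW hW' hWpos hκ hκ'
    (fun t => by positivity) hT'T hα0
    (fun x y t ht s hs => hbound x y t (hsubT ht) s (hsubT hs)) hinit hkB.le
    (x₁ := x₁) (y₁ := y₁) (t₁ := t₁) ⟨ht₁.1, ht₁T'.le⟩ (by
      have : κ t₁ = δ / 3 := by simp [hκdef]
      linarith)
  have htT : t ∈ Icc 0 T := ⟨ht.1.le, ht.2.le.trans hT'T.le⟩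
  have hle := hamiltonian_sub_le hH₁ hD hβ hsign hθ hL₂.le hlip hM hω.mono hhω hxy htT hα0.le
    (w := W t) (by linarith [hWN t ht.1.le]) huv (norm_inv_japaneseBracket_smul_le x)
    (norm_inv_japaneseBracket_smul_le y)
  have hσκ : σ ≤ δ / 3 * (Real.exp (k * (t - t₁)) * k) := by
    rw [hσ]
    have := ht.1.le
    gcongr
  rw [hD'D t htT] at hineq
  linarith

theorem proposition2p8 (n : ℕ) (T : ℝ) (hT : 0 < T)
    (H₁ : EuclideanSpace ℝ (Fin n) → ℝ → EuclideanSpace ℝ (Fin n) → ℝ)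
    (hH₁ : IsGeometricHamiltonian n T H₁)
    (D : ℝ → ℝ) (hD : IsLipschitzInSpace n T H₁ D)
    (β : ℝ → ℝ) (hβ : IsSignLike β)
    (h : EuclideanSpace ℝ (Fin n) → ℝ) (hh : HasModulus n h)
    (hsign : ChangesSignAtUnitSphere n h ∨ VanishesOutsideUnitBall n h)
    (u₀ : EuclideanSpace ℝ (Fin n) → ℝ) (L₀ : ℝ≥0) (hu₀ : LipschitzWith L₀ u₀)
    (θ : ℝ) (hθ : 0 < θ)
    (u : EuclideanSpace ℝ (Fin n) → ℝ → ℝ)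
    (hu : IsCauchySolution n T (fun x t r p => H₁ x t p + θ * (β r * h p)) u₀ u) :
    ∀ x y : EuclideanSpace ℝ (Fin n), ∀ t ∈ Ico 0 T,
      |u x t - u y t| ≤ max (L₀ : ℝ) 1 * Real.exp (∫ s in (0 : ℝ)..t, D s) * ‖x - y‖ := by
  have key : ∀ x y : EuclideanSpace ℝ (Fin n), ∀ t ∈ Ico 0 T,
      u x t - u y t ≤ max (L₀ : ℝ) 1 * Real.exp (∫ s in (0 : ℝ)..t, D s) * ‖x - y‖ := by
    intro x y t ht
    have hlim : Tendsto (fun N : ℝ => N * Real.exp (∫ s in (0 : ℝ)..t, D s) * ‖x - y‖)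
        (𝓝[>] (max (L₀ : ℝ) 1))
        (𝓝 (max (L₀ : ℝ) 1 * Real.exp (∫ s in (0 : ℝ)..t, D s) * ‖x - y‖)) :=
      ((tendsto_id.mul_const _).mul_const _).mono_left nhdsWithin_le_nhds
    refine ge_of_tendsto hlim ?_
    filter_upwards [self_mem_nhdsWithin] with N hN
    exact hu.sub_le_mul_norm_sub hT hH₁ hD hβ hh hsign hu₀ hθ
      ((le_max_right _ _).trans_lt hN) ((le_max_left _ _).trans hN.le) x y ht
  intro x y t ht
  rw [abs_sub_le_iff]
  exact ⟨key x y t ht, norm_sub_rev x y ▸ key y x t ht⟩
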